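/- Let $S$ be a finite nonempty set and let $p:2^S\to\mathbb Z\cup\{-\infty\}$ be supermodular, i.e. $p(X)+p(Y)\le p(X\cap Y)+p(X\cup Y)$ for all $X,Y\subseteq S$, with $p(\emptyset)=0$ and $p(S)$ finite. Let $B=\{x\in\mathbb R^S : \sum_{s\in S}x(s)=p(S),\ \sum_{s\in Z}x(s)\ge p(Z)\text{ for all }Z\subseteq S\}$ be the base-polyhedron of $p$. For $\pi\in\mathbb Z^S$ let $\hat p(\pi)\in\mathbb Z\cup\{-\infty\}$ be the linear (Lovász) extension $$\hat p(\pi)=p(I_n)\,\pi(s_n)+\sum_{j=1}^{n-1}p(I_j)\,[\pi(s_j)-\pi(s_{j+1})],$$ where $n=|S|$, the elements of $S$ are indexed so that $\pi(s_1)\ge\dots\ge\pi(s_n)$, $I_j=\{s_1,\dots,s_j\}$, and $(-\infty)\cdot 0=0$. For integers $a\ge 1$ and $\ell$ put $$\psi_a(\ell)=k\,(\ell-a k),\qquad k=\left\lfloor \tfrac12\left(\tfrac{\ell}{a}+1\right)\right\rfloor .$$ Let $c\in\mathbb Z^S$ with $c(s)\ge 1$ for every $s\in S$. Then the minimum and the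 maximum below are attained, are finite, and satisfy $$\min\Big\{\sum_{s\in S}c(s)\,x(s)^2 : x\in B\cap\mathbb Z^S\Big\}=\max\Big\{\hat p(\pi)-\sum_{s\in S}\psi_{c(s)}(\pi(s)) : \pi\in\mathbb Z^S\Big\}.$$ Moreover, for every $s\in S$, $\psi_{c(s)}$ is the integer conjugate of $k\mapsto c(s)k^2$: for every $\ell\in\mathbb Z$, $\psi_{c(s)}(\ell)=\max\{k\ell-c(s)k^2 : k\in\mathbb Z\}$. -/

import Mathlib

section Defs

variable {S : Type*} [Fintype S]

/-- A set function with values in `ℤ ∪ {-∞}` is (fully) supermodular if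
`p X + p Y ≤ p (X ∩ Y) + p (X ∪ Y)` for all `X, Y`. As `⊥` is absorbing for addition, the
inequality is void when `p X` or `p Y` is `-∞`, and it forces `p (X ∩ Y)` and `p (X ∪ Y)` to be
finite when `p X` and `p Y` are. -/
def IsSupermodular [DecidableEq S] (p : Finset S → WithBot ℤ) : Prop :=
  ∀ X Y : Finset S, p X + p Y ≤ p (X ∩ Y) + p (X ∪ Y)

/-- The base-polyhedron `{x ∈ ℝ^S : x(S) = p(S), x(Z) ≥ p(Z) for all Z ⊆ S}`, where
`x(Z)` is the sum of `x` over `Z`. -/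
def basePolyhedron (p : Finset S → WithBot ℤ) : Set (S → ℝ) :=
  {x | ((∑ s, x s : ℝ) : WithBot ℝ) = (p Finset.univ).map (fun k : ℤ => (k : ℝ)) ∧
    ∀ Z : Finset S, (p Z).map (fun k : ℤ => (k : ℝ)) ≤ ((∑ s ∈ Z, x s : ℝ) : WithBot ℝ)}

/-- The integral members of a subset of `ℝ^S`, as integer vectors. -/
def integralPoints (B : Set (S → ℝ)) : Set (S → ℤ) :=
  {x | (fun s => (x s : ℝ)) ∈ B}

/-- The initial segment `{s_0, …, s_j}` of an enumeration `s_0, …, s_m` of `S`. -/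
def initialSegment {m : ℕ} (e : Fin (m + 1) ≃ S) (j : Fin (m + 1)) : Finset S :=
  (Finset.Iic j).map e.toEmbedding

/-- The expression defining the linear (Lovász) extension of `p` at `π`, for a given enumeration
`s_0, …, s_m` of `S`:
`p(I_m) π(s_m) + ∑_{j < m} p(I_j) (π(s_j) - π(s_{j+1}))`.
The product in `WithBot ℤ` satisfies `⊥ * 0 = 0`, and `⊥ * k = ⊥` for `k ≠ 0`. -/
def lovaszAlong (p : Finset S → WithBot ℤ) (π : S → ℤ) {m : ℕ} (e : Fin (m + 1) ≃ S) :
    WithBot ℤ :=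
  p (initialSegment e (Fin.last m)) * ((π (e (Fin.last m)) : ℤ) : WithBot ℤ) +
    ∑ j : Fin m, p (initialSegment e j.castSucc) *
      ((π (e j.castSucc) - π (e j.succ) : ℤ) : WithBot ℤ)

/-- The elements of `S` can be listed in the order of non-increasing values of `π`. -/
theorem exists_antitone_enum [Nonempty S] (π : S → ℤ) :
    ∃ e : Fin (Fintype.card S - 1 + 1) ≃ S, Antitone (π ∘ e) := by
  have hc : Fintype.card S = Fintype.card S - 1 + 1 :=
    (Nat.sub_add_cancel Fintype.card_pos).symm
  let e₀ : Fin (Fintype.card S - 1 + 1) ≃ S := (Fintype.equivFinOfCardEq hc).symm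
  let f : Fin (Fintype.card S - 1 + 1) → ℤ := fun i => -π (e₀ i)
  refine ⟨(Tuple.sort f).trans e₀, fun i j hij => ?_⟩
  have h := Tuple.monotone_sort f hij
  simp only [f, Function.comp_apply] at h
  simpa using h

/-- The linear (Lovász) extension of the set function `p`, for an enumeration of `S` along which
`π` is non-increasing; by `lovaszExtension_eq` it does not depend on the enumeration. -/
noncomputable def lovaszExtension [Nonempty S] (p : Finset S → WithBot ℤ) (π : S → ℤ) :
    WithBot ℤ :=
  lovaszAlong p π (exists_antitone_enum π).choose

theorem initialSegment_eq_of_lt {m : ℕ} (π : S → ℤ) (e : Fin (m + 1) ≃ S)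
    (he : Antitone (π ∘ e)) (j : Fin m) (hj : π (e j.succ) < π (e j.castSucc)) :
    initialSegment e j.castSucc = Finset.univ.filter (fun s => π (e j.castSucc) ≤ π s) := by
  ext s
  obtain ⟨i, rfl⟩ := e.surjective s
  simp only [initialSegment, Finset.mem_map_equiv, Equiv.symm_apply_apply, Finset.mem_Iic,
    Finset.mem_filter, Finset.mem_univ, true_and]
  refine ⟨fun h => he h, fun h => ?_⟩
  by_contra hc
  have h1 : j.succ ≤ i := by
    rw [not_le] at hc
    exact Fin.castSucc_lt_iff_succ_le.mp hc
  have h2 : π (e i) ≤ π (e j.succ) := he h1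
  omega

theorem initialSegment_last {m : ℕ} (e : Fin (m + 1) ≃ S) :
    initialSegment e (Fin.last m) = Finset.univ := by
  ext s
  simp [initialSegment, Finset.mem_map_equiv, Fin.le_last]

/-- Two enumerations along which `π` is non-increasing give the same value. -/
theorem lovaszAlong_eq {m : ℕ} (p : Finset S → WithBot ℤ) (π : S → ℤ)
    (e e' : Fin (m + 1) ≃ S) (he : Antitone (π ∘ e)) (he' : Antitone (π ∘ e')) :
    lovaszAlong p π e = lovaszAlong p π e' := by
  have hval : ∀ i, π (e i) = π (e' i) := by
    have h := Tuple.unique_monotone (f := fun i => -π (e i)) (σ := Equiv.refl _)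
      (τ := e'.trans e.symm) (fun i j hij => neg_le_neg (he hij))
      (fun i j hij => by simpa using he' hij)
    intro i
    have hi := congrFun h i
    simpa using hi
  unfold lovaszAlong
  rw [initialSegment_last, initialSegment_last, hval]
  congr 1
  refine Finset.sum_congr rfl fun j _ => ?_
  have hle : π (e j.succ) ≤ π (e j.castSucc) := he (Fin.castSucc_lt_succ (i := j)).le
  rcases hle.lt_or_eq with hlt | heq
  · rw [initialSegment_eq_of_lt π e he j hlt,
      initialSegment_eq_of_lt π e' he' j (by rw [← hval, ← hval]; exact hlt)]
    simp only [hval]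
  · have h0 : π (e j.castSucc) - π (e j.succ) = 0 := by omega
    have h0' : π (e' j.castSucc) - π (e' j.succ) = 0 := by rw [← hval, ← hval]; exact h0
    rw [h0, h0']
    simp

theorem lovaszExtension_eq [Nonempty S] (p : Finset S → WithBot ℤ) (π : S → ℤ)
    (e : Fin (Fintype.card S - 1 + 1) ≃ S) (he : Antitone (π ∘ e)) :
    lovaszExtension p π = lovaszAlong p π e :=
  lovaszAlong_eq p π _ e (exists_antitone_enum π).choose_spec he

/-- The integer `⌊(ℓ / a + 1) / 2⌋`, computed in `ℚ`. -/
def conjIndex (a ℓ : ℤ) : ℤ :=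
  ⌊(1 / 2 : ℚ) * ((ℓ : ℚ) / (a : ℚ) + 1)⌋

/-- The function `ℓ ↦ k (ℓ - a k)` with `k = ⌊(ℓ / a + 1) / 2⌋`. -/
def squareConj (a ℓ : ℤ) : ℤ :=
  conjIndex a ℓ * (ℓ - a * conjIndex a ℓ)

end Defs

/-!
Weak duality is termwise: `p̂(π) ≤ ∑ x(s) π(s)` for `x` in the base-polyhedron, and
`x(s) π(s) ≤ f(x(s)) + f*(π(s))`. For strong duality take an integral `x` minimizing
`∑ f_s(x(s))`. If every tight set containing `t` contains `s`, then moving one unit from `t` to `s`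
keeps `x` feasible, so the left slope of `f_t` at `x(t)` is at most the right slope of `f_s` at
`x(s)`. This exchange relation is a preorder, so some `π` that is monotone for it lies between the
left and the right slopes. Lying between the slopes gives equality in Fenchel's inequality by
convexity, and monotonicity makes the upper level sets of `π` tight, which gives
`p̂(π) = ∑ x(s) π(s)`.
-/

section OrderAndSums

theorem exists_isMinOn_of_bddBelow_image {α : Type*} {A : Set α} {F : α → ℤ} (hA : A.Nonempty)
    (hF : BddBelow (F '' A)) : ∃ x ∈ A, IsMinOn F A x := by
  obtain ⟨x, hx, hFx⟩ := Int.csInf_mem (hA.image F) hF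
  exact ⟨x, hx, fun y hy => hFx.trans_le (csInf_le hF ⟨y, hy, rfl⟩)⟩

theorem le_coe_sub_one_of_lt_coe {w : WithBot ℤ} {n : ℤ} (h : w < n) :
    w ≤ ((n - 1 : ℤ) : WithBot ℤ) := by
  cases w with
  | bot => exact bot_le
  | coe k => exact WithBot.coe_le_coe.mpr (Int.le_sub_one_of_lt (WithBot.coe_lt_coe.mp h))

theorem eq_coe_and_eq_coe_of_coe_add_coe_le {α : Type*} [AddCommMonoid α] [PartialOrder α]
    [IsOrderedCancelAddMonoid α] {a b : WithBot α} {m n : α} (ha : a ≤ m) (hb : b ≤ n)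
    (h : (m : WithBot α) + n ≤ a + b) : a = m ∧ b = n := by
  cases a with
  | bot => simp [← WithBot.coe_add] at h
  | coe a =>
    cases b with
    | bot => simp [← WithBot.coe_add] at h
    | coe b =>
      simp only [← WithBot.coe_add, WithBot.coe_le_coe, WithBot.coe_inj] at *
      exact (add_eq_add_iff_eq_and_eq ha hb).mp (le_antisymm (add_le_add ha hb) h)

theorem sum_mul_eq_sum_Iic_mul_sub {R : Type*} [NonUnitalNonAssocRing R] {m : ℕ}
    (a b : Fin (m + 1) → R) :
    ∑ i, a i * b i = (∑ i ∈ Finset.Iic (Fin.last m), a i) * b (Fin.last m) +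
      ∑ j : Fin m, (∑ i ∈ Finset.Iic j.castSucc, a i) * (b j.castSucc - b j.succ) := by
  have Iic_last (n : ℕ) : Finset.Iic (Fin.last n) = Finset.univ := Finset.Iic_top
  induction m with
  | zero =>
    rw [Iic_last]
    simp
  | succ m ih =>
    have sum_Iic_castSucc (j : Fin (m + 1)) :
        ∑ i ∈ Finset.Iic j.castSucc, a i = ∑ i ∈ Finset.Iic j, a i.castSucc := by
      rw [← Fin.map_castSuccEmb_Iic, Finset.sum_map]
      rfl
    rw [Fin.sum_univ_castSucc, ih (fun i => a i.castSucc) (fun i => b i.castSucc),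
      Fin.sum_univ_castSucc (n := m)]
    simp only [Iic_last, Fin.sum_univ_castSucc (n := m + 1), sum_Iic_castSucc, Fin.succ_last,
      Fin.succ_castSucc, add_mul, mul_sub]
    abel

theorem exists_monotone_between {S α : Type*} [Finite S] [SemilatticeSup α] {r : S → S → Prop}
    (refl : ∀ s, r s s) (trans : ∀ {t s u}, r t s → r s u → r t u) {lo hi : S → α}
    (h : ∀ t s, r t s → lo t ≤ hi s) :
    ∃ π : S → α, (∀ t s, r t s → π t ≤ π s) ∧ ∀ s, lo s ≤ π s ∧ π s ≤ hi s := by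
  classical
  have := Fintype.ofFinite S
  let below (s : S) : Finset S := {t | r t s}
  have mem_below {t s : S} : t ∈ below s ↔ r t s := by simp [below]
  have self_mem (s : S) : s ∈ below s := mem_below.mpr (refl s)
  refine ⟨fun s => (below s).sup' ⟨s, self_mem s⟩ lo, fun t s hts => ?_, fun s => ⟨?_, ?_⟩⟩
  · exact Finset.sup'_mono _ (fun u hu => mem_below.mpr (trans (mem_below.mp hu) hts)) _
  · exact Finset.le_sup' lo (self_mem s)
  · exact Finset.sup'_le _ _ fun t ht => h t s (mem_below.mp ht)

end OrderAndSums

section Conjugates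

/-- Integer convexity of a function on `ℤ`, as monotonicity of its forward differences. -/
def IsDiscreteConvex (f : ℤ → ℤ) : Prop :=
  Monotone fun k => f (k + 1) - f k

/-- `g` is the integer conjugate of `f`: `g(ℓ) = max {k ℓ - f(k) : k ∈ ℤ}`, the maximum being
attained for every `ℓ`. -/
def IsIntegerConjugate (f g : ℤ → ℤ) : Prop :=
  ∀ l, IsGreatest {w | ∃ k, w = k * l - f k} (g l)

theorem IsIntegerConjugate.mul_sub_le {f g : ℤ → ℤ} (hg : IsIntegerConjugate f g) (k l : ℤ) :
    k * l - f k ≤ g l :=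
  (hg l).2 ⟨k, rfl⟩

theorem IsIntegerConjugate.bddBelow_range {f g : ℤ → ℤ} (hg : IsIntegerConjugate f g) :
    BddBelow (Set.range f) := by
  refine ⟨-g 0, ?_⟩
  rintro _ ⟨k, rfl⟩
  linarith [hg.mul_sub_le k 0]

theorem IsDiscreteConvex.slope_le {f : ℤ → ℤ} (hf : IsDiscreteConvex f) {j k : ℤ} (h : j ≤ k) :
    f j - f (j - 1) ≤ f (k + 1) - f k := by
  simpa using hf (show j - 1 ≤ k by lia)

theorem IsDiscreteConvex.isGreatest_of_slopes {f : ℤ → ℤ} (hf : IsDiscreteConvex f) {k l : ℤ}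
    (left : f k - f (k - 1) ≤ l) (right : l ≤ f (k + 1) - f k) :
    IsGreatest {w | ∃ j, w = j * l - f j} (k * l - f k) := by
  have up : ∀ j, k ≤ j → j * l - f j ≤ k * l - f k := by
    refine Int.leInduction le_rfl fun j hkj ih => ?_
    have slope : f (k + 1) - f k ≤ f (j + 1) - f j := hf hkj
    linarith
  have down : ∀ j ≤ k, j * l - f j ≤ k * l - f k := by
    refine Int.leInductionDown le_rfl fun j hjk ih => ?_
    have slope : f j - f (j - 1) ≤ f k - f (k - 1) := by
      simpa using hf (show j - 1 ≤ k - 1 by lia)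
    linarith
  refine ⟨⟨k, rfl⟩, ?_⟩
  rintro _ ⟨j, rfl⟩
  exact (le_total k j).elim (up j) (down j)

theorem isDiscreteConvex_mul_sq {a : ℤ} (ha : 0 ≤ a) : IsDiscreteConvex fun k => a * k ^ 2 := by
  intro j k hjk
  change a * (j + 1) ^ 2 - a * j ^ 2 ≤ a * (k + 1) ^ 2 - a * k ^ 2
  linarith [mul_le_mul_of_nonneg_left hjk ha]

theorem mul_two_mul_conjIndex_sub_one_le {a : ℤ} (ha : 0 < a) (l : ℤ) :
    a * (2 * conjIndex a l - 1) ≤ l := by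
  have ha' : (0 : ℚ) < a := by exact_mod_cast ha
  have floor_le : (conjIndex a l : ℚ) ≤ 1 / 2 * (l / a + 1) := Int.floor_le _
  have : (2 * conjIndex a l - 1 : ℚ) ≤ l / a := by linarith
  rw [le_div_iff₀' ha'] at this
  exact_mod_cast this

theorem le_mul_two_mul_conjIndex_add_one {a : ℤ} (ha : 0 < a) (l : ℤ) :
    l ≤ a * (2 * conjIndex a l + 1) := by
  have ha' : (0 : ℚ) < a := by exact_mod_cast ha
  have lt_floor_add_one : 1 / 2 * (l / a + 1 : ℚ) < conjIndex a l + 1 := Int.lt_floor_add_one _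
  have : (l / a : ℚ) ≤ 2 * conjIndex a l + 1 := by linarith
  rw [div_le_iff₀' ha'] at this
  exact_mod_cast this

theorem isIntegerConjugate_squareConj {a : ℤ} (ha : 0 < a) :
    IsIntegerConjugate (fun k => a * k ^ 2) (squareConj a) := by
  intro l
  have value : squareConj a l = conjIndex a l * l - a * conjIndex a l ^ 2 := by
    unfold squareConj
    ring
  rw [value]
  refine (isDiscreteConvex_mul_sq ha.le).isGreatest_of_slopes ?_ ?_
  · linarith [mul_two_mul_conjIndex_sub_one_le ha l]
  · linarith [le_mul_two_mul_conjIndex_add_one ha l]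

end Conjugates

section TightSets

variable {S : Type*} {p : Finset S → WithBot ℤ} {x : S → ℤ}

/-- The modular set function `Z ↦ x(Z)` of an integer vector `x`, with values in the same type
`ℤ ∪ {-∞}` as `p`. -/
def modular (x : S → ℤ) (Z : Finset S) : WithBot ℤ :=
  ((∑ s ∈ Z, x s : ℤ) : WithBot ℤ)

/-- `Z` is tight for `x` if the inequality `x(Z) ≥ p(Z)` holds with equality. -/
def IsTight (p : Finset S → WithBot ℤ) (x : S → ℤ) (Z : Finset S) : Prop :=
  p Z = modular x Z

theorem mem_integralPoints_basePolyhedron [Fintype S] :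
    x ∈ integralPoints (basePolyhedron p) ↔ IsTight p x Finset.univ ∧ p ≤ modular x := by
  have coe_sum (Z : Finset S) : ((∑ s ∈ Z, (x s : ℝ) : ℝ) : WithBot ℝ) =
      (modular x Z).map (fun k : ℤ => (k : ℝ)) := by
    rw [modular, WithBot.map_coe, Int.cast_sum]
  have map_le (v w : WithBot ℤ) :
      v.map (fun k : ℤ => (k : ℝ)) ≤ w.map (fun k : ℤ => (k : ℝ)) ↔ v ≤ w :=
    WithBot.map_le_iff _ Int.cast_le
  simp only [integralPoints, basePolyhedron, Set.mem_ofPred_eq, coe_sum, map_le,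
    (WithBot.map_injective Int.cast_injective).eq_iff, IsTight, Pi.le_def, eq_comm]

theorem isTight_empty (h : p ∅ = 0) : IsTight p x ∅ := by
  simp [IsTight, modular, h]

section Lattice

variable [DecidableEq S]

theorem modular_add_modular (x : S → ℤ) (X Y : Finset S) :
    modular x X + modular x Y = modular x (X ∩ Y) + modular x (X ∪ Y) := by
  simp only [modular, ← WithBot.coe_add, WithBot.coe_inj]
  rw [add_comm (∑ s ∈ X ∩ Y, x s), Finset.sum_union_inter]

theorem IsTight.inter_union (hp : IsSupermodular p) (hx : p ≤ modular x) {X Y : Finset S}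
    (hX : IsTight p x X) (hY : IsTight p x Y) : IsTight p x (X ∩ Y) ∧ IsTight p x (X ∪ Y) :=
  eq_coe_and_eq_coe_of_coe_add_coe_le (hx _) (hx _) <|
    calc modular x (X ∩ Y) + modular x (X ∪ Y)
      _ = p X + p Y := by rw [hX, hY, modular_add_modular x X Y]
      _ ≤ p (X ∩ Y) + p (X ∪ Y) := hp X Y

theorem IsTight.finset_sup (hp : IsSupermodular p) (h_empty : p ∅ = 0) (hx : p ≤ modular x)
    {ι : Type*} {A : Finset ι} {Z : ι → Finset S} (hZ : ∀ i ∈ A, IsTight p x (Z i)) :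
    IsTight p x (A.sup Z) :=
  Finset.sup_induction (isTight_empty h_empty)
    (fun _ hX _ hY => (hX.inter_union hp hx hY).2) hZ

theorem IsTight.finset_inf [Fintype S] (hp : IsSupermodular p) (hx : p ≤ modular x)
    (h_univ : IsTight p x Finset.univ) {ι : Type*} {A : Finset ι} {Z : ι → Finset S}
    (hZ : ∀ i ∈ A, IsTight p x (Z i)) : IsTight p x (A.inf Z) :=
  Finset.inf_induction h_univ (fun _ hX _ hY => (hX.inter_union hp hx hY).1) hZ

end Lattice

section IntegralBase

theorem exists_le_modular [Finite S] (h_empty : p ∅ ≤ 0) : ∃ x, p ≤ modular x := by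
  obtain ⟨b, hb⟩ := (Set.finite_range p).bddAbove
  obtain ⟨M, hM⟩ := WithBot.ne_bot_iff_exists.mp
    ((WithBot.bot_lt_coe (0 : ℤ)).trans_le (le_max_right b 0)).ne'
  have hM0 : 0 ≤ M := WithBot.coe_le_coe.mp (hM ▸ le_max_right b 0)
  refine ⟨fun _ => M, fun Z => ?_⟩
  rcases Z.eq_empty_or_nonempty with rfl | ⟨s, hs⟩
  · simpa [modular] using h_empty
  · calc p Z ≤ M := hM ▸ (hb ⟨Z, rfl⟩).trans (le_max_left b 0)
      _ ≤ modular (fun _ => M) Z :=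
        WithBot.coe_le_coe.mpr (Finset.single_le_sum (f := fun _ => M) (fun _ _ => hM0) hs)

theorem exists_minimal_le_modular [Fintype S] (h_empty : p ∅ ≤ 0) (h_univ : p Finset.univ ≠ ⊥) :
    ∃ x, Minimal (p ≤ modular ·) x := by
  obtain ⟨q, hq⟩ := WithBot.ne_bot_iff_exists.mp h_univ
  have bounded : BddBelow ((fun x : S → ℤ => ∑ s, x s) '' {x | p ≤ modular x}) := by
    refine ⟨q, ?_⟩
    rintro _ ⟨x, hx, rfl⟩
    exact WithBot.coe_le_coe.mp (hq.trans_le (hx Finset.univ))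
  obtain ⟨x, hx, hmin⟩ := exists_isMinOn_of_bddBelow_image (exists_le_modular h_empty) bounded
  refine ⟨x, hx, fun y hy hyx => le_of_eq ?_⟩
  have sum_eq : ∑ s, y s = ∑ s, x s :=
    (Finset.sum_le_sum fun s _ => hyx s).antisymm (hmin hy)
  funext s
  exact ((Finset.sum_eq_sum_iff_of_le fun s _ => hyx s).mp sum_eq s (Finset.mem_univ s)).symm

theorem modular_sub_single [DecidableEq S] (x : S → ℤ) (s : S) (Z : Finset S) :
    modular (x - Pi.single s 1) Z =
      ((∑ t ∈ Z, x t - if s ∈ Z then 1 else 0 : ℤ) : WithBot ℤ) := by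
  simp [modular, Finset.sum_sub_distrib]

theorem exists_isTight_mem_of_minimal (hx : Minimal (p ≤ modular ·) x) (s : S) :
    ∃ Z, s ∈ Z ∧ IsTight p x Z := by
  classical
  by_contra! not_tight
  have lt_self : x - Pi.single s 1 < x := sub_lt_self x (Pi.single_pos.mpr one_pos)
  refine hx.not_prop_of_lt lt_self fun Z => ?_
  rw [modular_sub_single]
  split_ifs with hs
  · exact le_coe_sub_one_of_lt_coe ((hx.prop Z).lt_of_ne (not_tight Z hs))
  · rw [sub_zero]
    exact hx.prop Z

variable [Fintype S] [DecidableEq S]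

theorem isTight_univ_of_minimal (hp : IsSupermodular p) (h_empty : p ∅ = 0)
    (hx : Minimal (p ≤ modular ·) x) : IsTight p x Finset.univ := by
  choose Z mem_Z tight_Z using exists_isTight_mem_of_minimal hx
  have cover : Finset.univ.sup Z = Finset.univ :=
    Finset.eq_univ_iff_forall.mpr fun s => Finset.mem_sup.mpr ⟨s, Finset.mem_univ s, mem_Z s⟩
  exact cover ▸ IsTight.finset_sup hp h_empty hx.prop fun s _ => tight_Z s

theorem integralPoints_basePolyhedron_nonempty (hp : IsSupermodular p) (h_empty : p ∅ = 0)
    (h_univ : p Finset.univ ≠ ⊥) :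
    (integralPoints (basePolyhedron p)).Nonempty := by
  obtain ⟨x, hx⟩ := exists_minimal_le_modular h_empty.le h_univ
  exact ⟨x, mem_integralPoints_basePolyhedron.mpr
    ⟨isTight_univ_of_minimal hp h_empty hx, hx.prop⟩⟩

end IntegralBase

section Exchange

/-- The exchange relation of `x`: every tight set containing `t` contains `s`, that is, no tight
set obstructs moving one unit of `x` from `t` to `s`. -/
def IsExchangeable (p : Finset S → WithBot ℤ) (x : S → ℤ) (t s : S) : Prop :=
  ∀ Z, IsTight p x Z → t ∈ Z → s ∈ Z

theorem IsExchangeable.refl (s : S) : IsExchangeable p x s s :=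
  fun _ _ hs => hs

theorem IsExchangeable.trans {t s u : S} (hts : IsExchangeable p x t s)
    (hsu : IsExchangeable p x s u) : IsExchangeable p x t u :=
  fun Z hZ ht => hsu Z hZ (hts Z hZ ht)

theorem modular_add_single_sub_single [DecidableEq S] (x : S → ℤ) (s t : S) (Z : Finset S) :
    modular (x + Pi.single s 1 - Pi.single t 1) Z =
      ((∑ r ∈ Z, x r + (if s ∈ Z then 1 else 0) - if t ∈ Z then 1 else 0 : ℤ) : WithBot ℤ) := by
  simp [modular, Finset.sum_sub_distrib, Finset.sum_add_distrib]

variable [Fintype S]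

theorem isTight_of_exchangeable_closed [DecidableEq S] (hp : IsSupermodular p) (h_empty : p ∅ = 0)
    (hx : x ∈ integralPoints (basePolyhedron p)) {L : Finset S}
    (hL : ∀ t ∈ L, ∀ s, IsExchangeable p x t s → s ∈ L) : IsTight p x L := by
  obtain ⟨h_univ, h_le⟩ := mem_integralPoints_basePolyhedron.mp hx
  have separate : ∀ t ∈ L, ∀ s ∉ L, ∃ Z, IsTight p x Z ∧ t ∈ Z ∧ s ∉ Z := by
    intro t ht s hs
    simpa [IsExchangeable] using mt (hL t ht s) hs
  choose! Z tight_Z mem_Z notMem_Z using separate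
  have L_eq : L = L.sup fun t => Lᶜ.inf (Z t) := by
    ext s
    simp only [Finset.mem_sup, Finset.mem_inf, Finset.mem_compl]
    refine ⟨fun hs => ⟨s, hs, mem_Z s hs⟩, ?_⟩
    rintro ⟨t, ht, hs⟩
    by_contra hsL
    exact notMem_Z t ht s hsL (hs s hsL)
  rw [L_eq]
  exact IsTight.finset_sup hp h_empty h_le fun t ht => IsTight.finset_inf hp h_le h_univ
    fun s hs => tight_Z t ht s (Finset.mem_compl.mp hs)

theorem IsExchangeable.exchange_mem [DecidableEq S] {s t : S} (h : IsExchangeable p x t s)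
    (hx : x ∈ integralPoints (basePolyhedron p)) :
    x + Pi.single s 1 - Pi.single t 1 ∈ integralPoints (basePolyhedron p) := by
  obtain ⟨h_univ, h_le⟩ := mem_integralPoints_basePolyhedron.mp hx
  refine mem_integralPoints_basePolyhedron.mpr ⟨?_, fun Z => ?_⟩
  · rw [IsTight, h_univ, modular_add_single_sub_single]
    simp [modular]
  · rw [modular_add_single_sub_single]
    by_cases hZ : IsTight p x Z
    · have hts : t ∈ Z → s ∈ Z := h Z hZ
      refine (h_le Z).trans (WithBot.coe_le_coe.mpr ?_)
      split_ifs <;> lia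
    · refine (le_coe_sub_one_of_lt_coe ((h_le Z).lt_of_ne hZ)).trans (WithBot.coe_le_coe.mpr ?_)
      split_ifs <;> lia

theorem sum_exchange [DecidableEq S] {M : Type*} [AddCommGroup M] (f : S → ℤ → M) (x : S → ℤ)
    {s t : S} (hst : s ≠ t) :
    ∑ r, f r ((x + Pi.single s 1 - Pi.single t 1 : S → ℤ) r) =
      ∑ r, f r (x r) + ((f s (x s + 1) - f s (x s)) - (f t (x t) - f t (x t - 1))) := by
  rw [← sub_eq_iff_eq_add', ← Finset.sum_sub_distrib, Fintype.sum_eq_add s t hst]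
  · simp [hst, hst.symm, sub_eq_add_neg]
  · rintro r ⟨hrs, hrt⟩
    simp [hrs, hrt]

theorem IsExchangeable.slope_le {f : S → ℤ → ℤ} (hf : ∀ s, IsDiscreteConvex (f s))
    (hx : x ∈ integralPoints (basePolyhedron p))
    (hmin : IsMinOn (fun y => ∑ s, f s (y s)) (integralPoints (basePolyhedron p)) x)
    {s t : S} (h : IsExchangeable p x t s) :
    f t (x t) - f t (x t - 1) ≤ f s (x s + 1) - f s (x s) := by
  classical
  rcases eq_or_ne s t with rfl | hst
  · exact (hf s).slope_le le_rfl
  · have le_exchange := hmin (h.exchange_mem hx)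
    simp only [Set.mem_ofPred_eq, sum_exchange f x hst] at le_exchange
    linarith

theorem exists_potential_of_isMinOn [DecidableEq S] (hp : IsSupermodular p) (h_empty : p ∅ = 0)
    {f : S → ℤ → ℤ} (hf : ∀ s, IsDiscreteConvex (f s))
    (hx : x ∈ integralPoints (basePolyhedron p))
    (hmin : IsMinOn (fun y => ∑ s, f s (y s)) (integralPoints (basePolyhedron p)) x) :
    ∃ π : S → ℤ, (∀ t, IsTight p x {s | π t ≤ π s}) ∧
      ∀ s, f s (x s) - f s (x s - 1) ≤ π s ∧ π s ≤ f s (x s + 1) - f s (x s) := by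
  obtain ⟨π, mono, between⟩ := exists_monotone_between (r := IsExchangeable p x)
    IsExchangeable.refl IsExchangeable.trans fun _ _ h => h.slope_le hf hx hmin
  refine ⟨π, fun t => isTight_of_exchangeable_closed hp h_empty hx fun r hr s hrs => ?_, between⟩
  rw [Finset.mem_filter_univ] at hr ⊢
  exact hr.trans (mono r s hrs)

end Exchange

end TightSets

section LovaszExtension

variable {S : Type*} [Fintype S] [Nonempty S] {p q : Finset S → WithBot ℤ}

theorem lovaszExtension_modular (x π : S → ℤ) :
    lovaszExtension (modular x) π = ((∑ s, x s * π s : ℤ) : WithBot ℤ) := by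
  obtain ⟨e, he⟩ := exists_antitone_enum π
  rw [lovaszExtension_eq _ π e he, ← e.sum_comp, sum_mul_eq_sum_Iic_mul_sub]
  simp [lovaszAlong, modular, initialSegment, Finset.sum_map]

theorem lovaszExtension_mono (h_univ : p Finset.univ = q Finset.univ) (h : p ≤ q) (π : S → ℤ) :
    lovaszExtension p π ≤ lovaszExtension q π := by
  obtain ⟨e, he⟩ := exists_antitone_enum π
  rw [lovaszExtension_eq p π e he, lovaszExtension_eq q π e he, lovaszAlong, lovaszAlong,
    initialSegment_last, h_univ]
  gcongr with j
  · exact WithBot.coe_nonneg.mpr (sub_nonneg.mpr (he Fin.castSucc_lt_succ.le))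
  · exact h _

theorem lovaszExtension_congr_upperLevelSets (π : S → ℤ)
    (h : ∀ t, p {s | π t ≤ π s} = q {s | π t ≤ π s}) :
    lovaszExtension p π = lovaszExtension q π := by
  obtain ⟨e, he⟩ := exists_antitone_enum π
  have level_last : ({s | π (e (Fin.last _)) ≤ π s} : Finset S) = Finset.univ := by
    refine Finset.filter_true_of_mem fun s _ => ?_
    simpa using he (Fin.le_last (e.symm s))
  rw [lovaszExtension_eq p π e he, lovaszExtension_eq q π e he, lovaszAlong, lovaszAlong,
    initialSegment_last, ← level_last, h]
  congr 1
  refine Finset.sum_congr rfl fun j _ => ?_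
  rcases (he (Fin.castSucc_lt_succ (i := j)).le).lt_or_eq with drop | level
  · rw [initialSegment_eq_of_lt π e he j drop, h]
  · simp only [Function.comp_apply] at level
    simp [level]

theorem lovaszExtension_sub_conjugate_le {x π : S → ℤ} {f g : S → ℤ → ℤ}
    (hx : x ∈ integralPoints (basePolyhedron p))
    (fenchel : ∀ s, x s * π s - f s (x s) ≤ g s (π s)) :
    lovaszExtension p π + ((-∑ s, g s (π s) : ℤ) : WithBot ℤ) ≤
      ((∑ s, f s (x s) : ℤ) : WithBot ℤ) := by
  obtain ⟨h_univ, h_le⟩ := mem_integralPoints_basePolyhedron.mp hx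
  have linear_le : ∑ s, x s * π s + -∑ s, g s (π s) ≤ ∑ s, f s (x s) := by
    rw [← sub_eq_add_neg, ← Finset.sum_sub_distrib]
    exact Finset.sum_le_sum fun s _ => sub_le_comm.mp (fenchel s)
  calc lovaszExtension p π + ((-∑ s, g s (π s) : ℤ) : WithBot ℤ)
    _ ≤ lovaszExtension (modular x) π + ((-∑ s, g s (π s) : ℤ) : WithBot ℤ) := by
      gcongr
      exact lovaszExtension_mono h_univ h_le π
    _ ≤ ((∑ s, f s (x s) : ℤ) : WithBot ℤ) := by
      rw [lovaszExtension_modular]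
      exact_mod_cast linear_le

theorem lovaszExtension_sub_conjugate_eq {x π : S → ℤ} {f g : S → ℤ → ℤ}
    (tight : ∀ t, IsTight p x {s | π t ≤ π s})
    (fenchel : ∀ s, g s (π s) = x s * π s - f s (x s)) :
    lovaszExtension p π + ((-∑ s, g s (π s) : ℤ) : WithBot ℤ) =
      ((∑ s, f s (x s) : ℤ) : WithBot ℤ) := by
  rw [lovaszExtension_congr_upperLevelSets π tight, lovaszExtension_modular]
  norm_cast
  simp [fenchel, Finset.sum_sub_distrib]

end LovaszExtension

theorem mainTheorem10_general {S : Type*} [Fintype S] [DecidableEq S] [Nonempty S]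
    (p : Finset S → WithBot ℤ) (hp : IsSupermodular p) (hp_empty : p ∅ = 0)
    (hp_univ : p Finset.univ ≠ ⊥) (f g : S → ℤ → ℤ) (hf : ∀ s, IsDiscreteConvex (f s))
    (hg : ∀ s, IsIntegerConjugate (f s) (g s)) :
    ∃ v : ℤ,
      IsLeast {z : ℤ | ∃ x ∈ integralPoints (basePolyhedron p), z = ∑ s, f s (x s)} v ∧
      IsGreatest {w : WithBot ℤ | ∃ π : S → ℤ,
        w = lovaszExtension p π + ((-∑ s, g s (π s) : ℤ) : WithBot ℤ)} (v : WithBot ℤ) := by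
  choose b hb using fun s => (hg s).bddBelow_range
  have bounded : BddBelow
      ((fun x : S → ℤ => ∑ s, f s (x s)) '' integralPoints (basePolyhedron p)) := by
    refine ⟨∑ s, b s, ?_⟩
    rintro _ ⟨x, -, rfl⟩
    exact Finset.sum_le_sum fun s _ => hb s ⟨x s, rfl⟩
  obtain ⟨x, hx, hmin⟩ := exists_isMinOn_of_bddBelow_image
    (integralPoints_basePolyhedron_nonempty hp hp_empty hp_univ) bounded
  obtain ⟨π, tight, between⟩ := exists_potential_of_isMinOn hp hp_empty hf hx hmin
  have fenchel_eq (s : S) : g s (π s) = x s * π s - f s (x s) :=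
    (hg s (π s)).unique ((hf s).isGreatest_of_slopes (between s).1 (between s).2)
  refine ⟨∑ s, f s (x s), ⟨⟨x, hx, rfl⟩, ?_⟩, ⟨π, ?_⟩, ?_⟩
  · rintro _ ⟨y, hy, rfl⟩
    exact hmin hy
  · exact (lovaszExtension_sub_conjugate_eq tight fenchel_eq).symm
  · rintro _ ⟨π', rfl⟩
    exact lovaszExtension_sub_conjugate_le hx fun s => (hg s).mul_sub_le (x s) (π' s)

theorem mainTheorem10 {S : Type*} [Fintype S] [DecidableEq S] [Nonempty S]
    (p : Finset S → WithBot ℤ) (hp : IsSupermodular p) (hp_empty : p ∅ = 0)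
    (hp_univ : p Finset.univ ≠ ⊥) (c : S → ℤ) (hc : ∀ s, 1 ≤ c s) :
    (∃ v : ℤ,
      IsLeast {z : ℤ | ∃ x ∈ integralPoints (basePolyhedron p), z = ∑ s, c s * x s ^ 2} v ∧
      IsGreatest {w : WithBot ℤ | ∃ π : S → ℤ,
        w = lovaszExtension p π + ((-∑ s, squareConj (c s) (π s) : ℤ) : WithBot ℤ)}
        (v : WithBot ℤ)) ∧
    ∀ (s : S) (l : ℤ),
      IsGreatest {w : ℤ | ∃ k : ℤ, w = k * l - c s * k ^ 2} (squareConj (c s) l) := by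
  have hconj (s : S) := isIntegerConjugate_squareConj (hc s)
  exact ⟨mainTheorem10_general p hp hp_empty hp_univ (fun s k => c s * k ^ 2) _
    (fun s => isDiscreteConvex_mul_sq (zero_le_one.trans (hc s))) hconj, hconj⟩
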